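/- A \emph{4-regular graph gadget} is a finite graph (parallel edges and loops allowed) together with four half-edges labelled $0,1,2,3$, each incident with exactly one vertex, such that every vertex has degree $4$, where loops count twice and half-edges once. A \emph{route} joining half-edges $a$ and $b$ is a trail (no repeated edges, repeated vertices allowed) that starts with the half-edge $a$ and ends with the half-edge $b$; a route and its reversal are identified. For $\{a,b,c,d\}=\{0,1,2,3\}$, let $\mathrm{VR}(\{a,b\},\{c,d\})$ be the set of all pairs consisting of a route joining $a$ and $b$ and a route joining $c$ and $d$ which together travel every edge exactly once. Put $N=|\mathrm{VR}(\{0,1\},\{2,3\})|+|\mathrm{VR}(\{0,2\},\{1,3\})|+|\mathrm{VR}(\{0,3\},\{1,2\})|$. If $N\neq 0$, the \emph{signature} of the gadget is the triple $$\frac1N\Big(|\mathrm{VR}(\{0,1\},\{2,3\})|,\ |\mathrm{VR}(\{0,2\},\{1,3\})|,\ |\mathrm{VR}(\{0,3\},\{1,2\})|\Big).$$ Let $S\subset\mathbb{R}^3$ be the set of all vectors obtained by permuting the coordinates of some $(\alpha,\beta,\gamma)$ with $\alpha\ge\beta\ge\gamma\ge 0$, $\alpha+\beta+\gamma=1$ and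 $\gamma\ge f(\beta)$, where $$f(x)=\tfrac12(1-x)\Big(1-\exp\Big(\frac{2x}{x-1}\Big)\Big).$$ \textbf{Theorem.} For every $\vec s\in S$ and every $\varepsilon>0$ there is a 4-regular graph gadget which has a signature $\vec s\,'$ with $\|\vec s-\vec s\,'\|_1\le\varepsilon$. -/

import Mathlib

/-- A 4-regular graph gadget: a finite mixed (multi)graph with vertex set `V`, edge set `E` (the two
ends of an edge are given by `ends`; parallel edges and loops are permitted) and four labelled
half-edges `0, 1, 2, 3`, the half-edge `i` being incident with the single vertex `half i`, such that
every vertex has degree 4, where loops count twice and half-edges once. -/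
structure GraphGadget where
  V : Type
  E : Type
  finite_V : Finite V
  finite_E : Finite E
  ends : E → Sym2 V
  half : Fin 4 → V
  regular : ∀ v : V,
    {e : E | v ∈ ends e}.ncard + {e : E | ends e = s(v, v)}.ncard
      + {i : Fin 4 | half i = v}.ncard = 4

namespace GraphGadget

/-- `G.IsWalk u l w`: traversing the edges of `l` in order leads from the vertex `u` to the vertex
`w`. The starting vertex and the edges determine all the vertices that are visited, so a walk is
recorded by its list of edges. -/
def IsWalk (G : GraphGadget) : G.V → List G.E → G.V → Prop
  | u, [], w => u = w
  | u, e :: l, w => ∃ v : G.V, G.ends e = s(u, v) ∧ G.IsWalk v l w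

/-- `l` lists the edges of a route `r(a, b)`: a trail (no repeated edges, repeated vertices
allowed) that starts with the half-edge `a` and ends with the half-edge `b`. -/
def IsRoute (G : GraphGadget) (a b : Fin 4) (l : List G.E) : Prop :=
  G.IsWalk (G.half a) l (G.half b) ∧ l.Nodup

/-- The valid sets of routes of type `{{a, b}, {c, d}}`, for `a, b, c, d` the four labels in some
order: a route joining `a` and `b` and a route joining `c` and `d` which together travel every edge
exactly once. Routes are undirected; each is represented by its unique orientation from `a` to `b`,
respectively from `c` to `d`. -/
def VR (G : GraphGadget) (a b c d : Fin 4) : Set (List G.E × List G.E) :=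
  {p | G.IsRoute a b p.1 ∧ G.IsRoute c d p.2 ∧
    (p.1 ++ p.2).Nodup ∧ ∀ e : G.E, e ∈ p.1 ++ p.2}

/-- The numbers of valid sets of routes of the types `{{0,1},{2,3}}`, `{{0,2},{1,3}}`,
`{{0,3},{1,2}}`. -/
noncomputable def routeCount (G : GraphGadget) : Fin 3 → ℕ :=
  ![(G.VR 0 1 2 3).ncard, (G.VR 0 2 1 3).ncard, (G.VR 0 3 1 2).ncard]

/-- `s` is the signature of `G`: the numbers of valid sets of routes of the three types, divided by
their sum `N`. A gadget without any valid set of routes (`N = 0`) has no signature. -/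
def HasSignature (G : GraphGadget) (s : Fin 3 → ℝ) : Prop :=
  (∑ j, G.routeCount j) ≠ 0 ∧
    ∀ i, s i = (G.routeCount i : ℝ) / ((∑ j, G.routeCount j : ℕ) : ℝ)

end GraphGadget

/-- `f(x) = (1/2) (1 - x) (1 - exp (2x / (x - 1)))`. -/
noncomputable def boundaryFun (x : ℝ) : ℝ :=
  1 / 2 * (1 - x) * (1 - Real.exp (2 * x / (x - 1)))

/-- The region `S`: all vectors arising by a permutation of coordinates from some `(α, β, γ)` with
`α ≥ β ≥ γ ≥ 0`, `α + β + γ = 1` and `γ ≥ f(β)`. -/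
def signatureRegion : Set (Fin 3 → ℝ) :=
  {s | ∃ (σ : Equiv.Perm (Fin 3)) (α β γ : ℝ),
    α ≥ β ∧ β ≥ γ ∧ γ ≥ 0 ∧ α + β + γ = 1 ∧ γ ≥ boundaryFun β ∧ s = ![α, β, γ] ∘ σ}

namespace GraphGadget

/-! ### Walks, and the symmetries of the route counts. -/

section Basic

variable (G : GraphGadget)

/-! Write `(x, y, z)` for the three route counts of a gadget and use the coordinates `u = x / (y +
z)`, `v = (y - z) / (y + z)`. Joining two gadgets along two half-edges each gives bilinear formulas
for the counts (`routeCount_compose`), which in these coordinates read `(u, v), (u', v') ↦ (u + u',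
v * v')`. Relabelling half-edges permutes `x, y, z`. All signatures used are built by these two
operations from a single vertex, which has `(x, y, z) = (1, 1, 1)`, that is `(1/2, 0)`.

A chain of `m - 1` single vertices, relabelled, gives `(1/m, 1 - 2/m)`. A chain of `k` copies of
this gives `(k/m, (1 - 2/m)^k)`, and with `k/m → t` the closure of the attained pairs contains the
curve `(t, exp (-2t))`. Adding one vertex to a gadget and relabelling sends `(u, v)` to `(1/(2u+2),
u/(u+1))`, which lies on the line `v = 1 - 2u`; since the curve supplies every `u ≥ 0`, the closure
contains the segment `(r, 1 - 2r)`, `0 ≤ r ≤ 1/2`.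

Composing a point of the segment with a point of the curve gives `(u, (1 - 2r) * exp (-2(u - r)))`.
As `r` runs from `0` to `min u (1/2)`, the second coordinate passes from `exp (-2u)` to `max (1 -
2u) 0`, so by the intermediate value theorem everything between is in the closure
(`mem_attainsClosure`). With `y, x, z` in the roles of `α, β, γ`, the condition `γ ≤ β` becomes `1 -
2u ≤ v` and `γ ≥ f(β)` becomes `v ≤ exp (-2u)`. Continuity of the signature in `(u, v)` finishes the
proof. -/

theorem isWalk_append {u w : G.V} {l m : List G.E} :
    G.IsWalk u (l ++ m) w ↔ ∃ v, G.IsWalk u l v ∧ G.IsWalk v m w := by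
  induction l generalizing u with
  | nil => simp [IsWalk]
  | cons e l ih =>
    simp only [List.cons_append, IsWalk, ih]
    constructor
    · rintro ⟨v, hv, v', h1, h2⟩
      exact ⟨v', ⟨v, hv, h1⟩, h2⟩
    · rintro ⟨v', ⟨v, hv, h1⟩, h2⟩
      exact ⟨v, hv, v', h1, h2⟩

theorem IsWalk.reverse {G : GraphGadget} {u w : G.V} {l : List G.E} (h : G.IsWalk u l w) :
    G.IsWalk w l.reverse u := by
  induction l generalizing u with
  | nil => exact h.symm
  | cons e l ih =>
    obtain ⟨v, hv, h⟩ := h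
    rw [List.reverse_cons, isWalk_append]
    exact ⟨v, ih h, u, by rw [hv, Sym2.eq_swap], rfl⟩

/-- The list contains every element exactly once. -/
def Exhausts {α : Type*} (l : List α) : Prop := l.Nodup ∧ ∀ e, e ∈ l

theorem Exhausts.perm {α : Type*} {l m : List α} (h : l.Perm m) : Exhausts l ↔ Exhausts m := by
  simp [Exhausts, h.nodup_iff, h.mem_iff]

theorem mem_VR {a b c d : Fin 4} {p : List G.E × List G.E} :
    p ∈ G.VR a b c d ↔ G.IsWalk (G.half a) p.1 (G.half b) ∧ G.IsWalk (G.half c) p.2 (G.half d) ∧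
      Exhausts (p.1 ++ p.2) := by
  simp only [VR, IsRoute, Set.mem_ofPred_eq, Exhausts]
  constructor
  · rintro ⟨h1, h2, h3, h4⟩
    exact ⟨h1.1, h2.1, h3, h4⟩
  · rintro ⟨h1, h2, h3, h4⟩
    exact ⟨⟨h1, h3.of_append_left⟩, ⟨h2, h3.of_append_right⟩, h3, h4⟩

theorem finite_VR (a b c d : Fin 4) : (G.VR a b c d).Finite := by
  classical
  have := G.finite_E
  have := Fintype.ofFinite G.E
  have hf : {l : List G.E | l.Nodup}.Finite :=
    Set.finite_coe_iff.1 (inferInstanceAs (Finite {l : List G.E // l.Nodup}))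
  exact (hf.prod hf).subset fun p hp => ⟨hp.1.2, hp.2.1.2⟩

theorem ncard_VR_swap (a b c d : Fin 4) : (G.VR a b c d).ncard = (G.VR c d a b).ncard := by
  rw [← Set.ncard_image_of_injective (G.VR c d a b) Prod.swap_injective]
  congr 1
  ext ⟨l, m⟩
  rw [Set.image_swap_eq_preimage_swap]
  simp only [Set.mem_preimage, mem_VR, Prod.swap,
    Exhausts.perm (List.perm_append_comm (l₁ := l) (l₂ := m))]
  tauto

theorem VR_image_reverse (a b c d : Fin 4) :
    G.VR a b d c = Prod.map id List.reverse '' G.VR a b c d := by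
  ext ⟨l, m⟩
  simp only [Set.mem_image, mem_VR, Prod.exists, Prod.map_apply, id, Prod.mk.injEq]
  constructor
  · rintro ⟨h1, h2, h3⟩
    refine ⟨l, m.reverse, ⟨h1, h2.reverse, ?_⟩, rfl, m.reverse_reverse⟩
    exact (Exhausts.perm ((List.reverse_perm m).append_left l)).2 h3
  · rintro ⟨l, m, ⟨h1, h2, h3⟩, rfl, rfl⟩
    exact ⟨h1, h2.reverse, (Exhausts.perm ((List.reverse_perm m).append_left l)).2 h3⟩

/-- With `ncard_VR_swap` and the left version, this makes the count depend only on the pairing of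
the labels, although routes are stored with an orientation. -/
theorem ncard_VR_reverse_right (a b c d : Fin 4) :
    (G.VR a b d c).ncard = (G.VR a b c d).ncard := by
  rw [VR_image_reverse, Set.ncard_image_of_injective]
  exact Function.injective_id.prodMap List.reverse_injective

theorem ncard_VR_reverse_left (a b c d : Fin 4) :
    (G.VR b a c d).ncard = (G.VR a b c d).ncard := by
  rw [ncard_VR_swap, ncard_VR_reverse_right, ncard_VR_swap]

end Basic

section Counting

theorem ncard_setOf_sum {α β : Type*} [Finite α] [Finite β] (P : α ⊕ β → Prop) :
    {e | P e}.ncard = {a | P (.inl a)}.ncard + {b | P (.inr b)}.ncard := by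
  rw [← Set.ncard_image_of_injective {a | P (.inl a)} Sum.inl_injective,
    ← Set.ncard_image_of_injective {b | P (.inr b)} Sum.inr_injective, ← Set.ncard_union_eq]
  · congr 1
    ext (a | b) <;> simp
  · rw [Set.disjoint_left]
    rintro _ ⟨a, _, rfl⟩ ⟨b, _, h⟩
    cases h

open Classical in
/-- The number `1` for a true proposition and `0` for a false one. -/
noncomputable def truthCount (p : Prop) : ℕ := if p then 1 else 0

theorem ncard_setOf_bool (P : Bool → Prop) :
    {e | P e}.ncard = truthCount (P false) + truthCount (P true) := by
  classical
  rw [Set.ncard_eq_toFinset_card', Set.toFinset_ofPred, Finset.card_filter, Fintype.sum_bool,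
    add_comm]
  simp [truthCount]

theorem ncard_setOf_fin_four (P : Fin 4 → Prop) :
    {e | P e}.ncard =
      truthCount (P 0) + truthCount (P 1) + truthCount (P 2) + truthCount (P 3) := by
  classical
  rw [Set.ncard_eq_toFinset_card', Set.toFinset_ofPred, Finset.card_filter, Fin.sum_univ_four]
  simp [truthCount]

theorem truthCount_false : truthCount False = 0 := by simp [truthCount]

end Counting

/-! ### Composition of gadgets. -/

/-- The half-edge of the first gadget used by a connecting edge of `compose`. -/
def outPort : Bool → Fin 4
  | false => 2
  | true => 3

/-- The half-edge of the second gadget used by a connecting edge of `compose`. -/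
def inPort : Bool → Fin 4
  | false => 0
  | true => 1

/-- The ends of the edges of the composition of two gadgets. -/
def composeEnds (A B : GraphGadget) : A.E ⊕ B.E ⊕ Bool → Sym2 (A.V ⊕ B.V)
  | .inl e => (A.ends e).map .inl
  | .inr (.inl e) => (B.ends e).map .inr
  | .inr (.inr i) => s(.inl (A.half (outPort i)), .inr (B.half (inPort i)))

theorem map_inl_eq_mk {α β : Type*} {z : Sym2 α} {u : α} {x : α ⊕ β} :
    z.map .inl = s(.inl u, x) ↔ ∃ v, x = .inl v ∧ z = s(u, v) := by
  induction z with | _ a b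
  rcases x with x | x <;> simp

theorem map_inr_eq_mk {α β : Type*} {z : Sym2 β} {u : β} {x : α ⊕ β} :
    z.map .inr = s(.inr u, x) ↔ ∃ v, x = .inr v ∧ z = s(u, v) := by
  induction z with | _ a b
  rcases x with x | x <;> simp

theorem map_inr_ne_mk {α β : Type*} {z : Sym2 β} {u : α} {x : α ⊕ β} :
    z.map .inr ≠ s(.inl u, x) := by
  induction z with | _ a b
  simp

theorem map_inl_ne_mk {α β : Type*} {z : Sym2 α} {u : β} {x : α ⊕ β} :
    z.map .inl ≠ s(.inr u, x) := by
  induction z with | _ a b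
  simp

/-- The half-edges of the composition of two gadgets. -/
def composeHalf (A B : GraphGadget) : Fin 4 → A.V ⊕ B.V :=
  ![.inl (A.half 0), .inl (A.half 1), .inr (B.half 2), .inr (B.half 3)]

/-- At each vertex the ends of connecting edges replace exactly the half-edges that were joined, and
a connecting edge is never a loop. -/
theorem compose_regular (A B : GraphGadget) (v : A.V ⊕ B.V) :
    {e | v ∈ composeEnds A B e}.ncard + {e | composeEnds A B e = s(v, v)}.ncard
      + {i | composeHalf A B i = v}.ncard = 4 := by
  have := A.finite_E
  have := B.finite_E
  rcases v with v | v
  · have h := A.regular v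
    rw [ncard_setOf_fin_four] at h ⊢
    simp only [ncard_setOf_sum, ncard_setOf_bool]
    simp [composeEnds, composeHalf, map_inl_eq_mk, map_inr_ne_mk, outPort, inPort,
      eq_comm (a := v), truthCount_false] at h ⊢
    omega
  · have h := B.regular v
    rw [ncard_setOf_fin_four] at h ⊢
    simp only [ncard_setOf_sum, ncard_setOf_bool]
    simp [composeEnds, composeHalf, map_inr_eq_mk, map_inl_ne_mk, outPort, inPort,
      eq_comm (a := v), truthCount_false] at h ⊢
    omega

/-- The composition of two gadgets: the half-edges `2, 3` of `A` are joined with the half-edges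
`0, 1` of `B`. -/
abbrev compose (A B : GraphGadget) : GraphGadget where
  V := A.V ⊕ B.V
  E := A.E ⊕ B.E ⊕ Bool
  finite_V := have := A.finite_V; have := B.finite_V; inferInstance
  finite_E := have := A.finite_E; have := B.finite_E; inferInstance
  ends := composeEnds A B
  half := composeHalf A B
  regular := compose_regular A B

/-! ### Walks in a composition, cut at connecting edges. -/

section Compose

variable {A B : GraphGadget}

/-- A list of edges of the first gadget, seen in the composition. -/
def onLeft (A B : GraphGadget) (l : List A.E) : List (A.compose B).E := l.map Sum.inl

/-- A list of edges of the second gadget, seen in the composition. -/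
def onRight (A B : GraphGadget) (m : List B.E) : List (A.compose B).E :=
  m.map fun e => Sum.inr (Sum.inl e)

/-- A connecting edge of the composition. -/
def link (A B : GraphGadget) (i : Bool) : (A.compose B).E := Sum.inr (Sum.inr i)

theorem isWalk_onLeft_iff {u : A.V} {l : List A.E} {x : (A.compose B).V} :
    (A.compose B).IsWalk (.inl u) (onLeft A B l) x ↔ ∃ w, x = .inl w ∧ A.IsWalk u l w := by
  induction l generalizing u with
  | nil => simp [onLeft, IsWalk, eq_comm]
  | cons e l ih =>
    simp only [onLeft, List.map_cons, IsWalk] at ih ⊢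
    constructor
    · rintro ⟨v, hv, h⟩
      obtain ⟨v, rfl, hv'⟩ := map_inl_eq_mk.1 hv
      obtain ⟨w, rfl, h'⟩ := ih.1 h
      exact ⟨w, rfl, v, hv', h'⟩
    · rintro ⟨w, rfl, v, hv, h⟩
      exact ⟨.inl v, map_inl_eq_mk.2 ⟨v, rfl, hv⟩, ih.2 ⟨w, rfl, h⟩⟩

theorem isWalk_onRight_iff {u : B.V} {l : List B.E} {x : (A.compose B).V} :
    (A.compose B).IsWalk (.inr u) (onRight A B l) x ↔ ∃ w, x = .inr w ∧ B.IsWalk u l w := by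
  induction l generalizing u with
  | nil => simp [onRight, IsWalk, eq_comm]
  | cons e l ih =>
    simp only [onRight, List.map_cons, IsWalk] at ih ⊢
    constructor
    · rintro ⟨v, hv, h⟩
      obtain ⟨v, rfl, hv'⟩ := map_inr_eq_mk.1 hv
      obtain ⟨w, rfl, h'⟩ := ih.1 h
      exact ⟨w, rfl, v, hv', h'⟩
    · rintro ⟨w, rfl, v, hv, h⟩
      exact ⟨.inr v, map_inr_eq_mk.2 ⟨v, rfl, hv⟩, ih.2 ⟨w, rfl, h⟩⟩

theorem isWalk_link_inl {u : A.V} {i : Bool} {L : List (A.compose B).E} {x : (A.compose B).V} :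
    (A.compose B).IsWalk (.inl u) (link A B i :: L) x ↔
      u = A.half (outPort i) ∧ (A.compose B).IsWalk (.inr (B.half (inPort i))) L x := by
  simp only [IsWalk, link, compose, composeEnds]
  constructor
  · rintro ⟨v, hv, h⟩
    simp only [Sym2.eq_iff, Sum.inl.injEq, reduceCtorEq, and_false, or_false] at hv
    obtain ⟨rfl, rfl⟩ := hv
    exact ⟨rfl, h⟩
  · rintro ⟨rfl, h⟩
    exact ⟨_, rfl, h⟩

theorem isWalk_link_inr {u : B.V} {i : Bool} {L : List (A.compose B).E} {x : (A.compose B).V} :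
    (A.compose B).IsWalk (.inr u) (link A B i :: L) x ↔
      u = B.half (inPort i) ∧ (A.compose B).IsWalk (.inl (A.half (outPort i))) L x := by
  simp only [IsWalk, link, compose, composeEnds]
  constructor
  · rintro ⟨v, hv, h⟩
    simp only [Sym2.eq_iff, Sum.inr.injEq, reduceCtorEq, false_and, false_or] at hv
    obtain ⟨rfl, rfl⟩ := hv
    exact ⟨rfl, h⟩
  · rintro ⟨rfl, h⟩
    exact ⟨_, Sym2.eq_swap, h⟩

theorem isWalk_onLeft_link {u : A.V} {l : List A.E} {i : Bool} {L : List (A.compose B).E}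
    {x : (A.compose B).V} :
    (A.compose B).IsWalk (.inl u) (onLeft A B l ++ link A B i :: L) x ↔
      A.IsWalk u l (A.half (outPort i)) ∧
        (A.compose B).IsWalk (.inr (B.half (inPort i))) L x := by
  rw [isWalk_append]
  constructor
  · rintro ⟨v, h₀, h'⟩
    obtain ⟨w, rfl, h⟩ := isWalk_onLeft_iff.1 h₀
    obtain ⟨rfl, h''⟩ := isWalk_link_inl.1 h'
    exact ⟨h, h''⟩
  · rintro ⟨h, h'⟩
    exact ⟨_, isWalk_onLeft_iff.2 ⟨_, rfl, h⟩, isWalk_link_inl.2 ⟨rfl, h'⟩⟩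

theorem isWalk_onRight_link {u : B.V} {l : List B.E} {i : Bool} {L : List (A.compose B).E}
    {x : (A.compose B).V} :
    (A.compose B).IsWalk (.inr u) (onRight A B l ++ link A B i :: L) x ↔
      B.IsWalk u l (B.half (inPort i)) ∧
        (A.compose B).IsWalk (.inl (A.half (outPort i))) L x := by
  rw [isWalk_append]
  constructor
  · rintro ⟨v, h₀, h'⟩
    obtain ⟨w, rfl, h⟩ := isWalk_onRight_iff.1 h₀
    obtain ⟨rfl, h''⟩ := isWalk_link_inr.1 h'
    exact ⟨h, h''⟩
  · rintro ⟨h, h'⟩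
    exact ⟨_, isWalk_onRight_iff.2 ⟨_, rfl, h⟩, isWalk_link_inr.2 ⟨rfl, h'⟩⟩

/-- Edges of the first gadget cannot leave its side, so the first other edge of the walk must be a
connecting edge. -/
theorem IsWalk.inl_cases {u : A.V} {L : List (A.compose B).E} {x : (A.compose B).V}
    (h : (A.compose B).IsWalk (.inl u) L x) :
    (∃ l, L = onLeft A B l) ∨ ∃ l i L', L = onLeft A B l ++ link A B i :: L' := by
  induction L generalizing u with
  | nil => exact .inl ⟨[], rfl⟩
  | cons e L ih =>
    obtain ⟨v, hv, h⟩ := h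
    rcases e with e | e | i
    · obtain ⟨v, rfl, -⟩ := map_inl_eq_mk.1 hv
      rcases ih h with ⟨l, rfl⟩ | ⟨l, i, L', rfl⟩
      · exact .inl ⟨e :: l, rfl⟩
      · exact .inr ⟨e :: l, i, L', rfl⟩
    · exact (map_inr_ne_mk hv).elim
    · exact .inr ⟨[], i, L, rfl⟩

theorem IsWalk.inr_cases {u : B.V} {L : List (A.compose B).E} {x : (A.compose B).V}
    (h : (A.compose B).IsWalk (.inr u) L x) :
    (∃ l, L = onRight A B l) ∨ ∃ l i L', L = onRight A B l ++ link A B i :: L' := by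
  induction L generalizing u with
  | nil => exact .inl ⟨[], rfl⟩
  | cons e L ih =>
    obtain ⟨v, hv, h⟩ := h
    rcases e with e | e | i
    · exact (map_inl_ne_mk hv).elim
    · obtain ⟨v, rfl, -⟩ := map_inr_eq_mk.1 hv
      rcases ih h with ⟨l, rfl⟩ | ⟨l, i, L', rfl⟩
      · exact .inl ⟨e :: l, rfl⟩
      · exact .inr ⟨e :: l, i, L', rfl⟩
    · exact .inr ⟨[], i, L, rfl⟩

theorem onLeft_injective : Function.Injective (onLeft A B) :=
  List.map_injective_iff.2 Sum.inl_injective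

theorem onRight_injective : Function.Injective (onRight A B) :=
  List.map_injective_iff.2 (Sum.inr_injective.comp Sum.inl_injective)

/-- The displayed connecting edge is the first edge outside the first gadget, so the decomposition
is unique. -/
theorem onLeft_append_link_inj {l l' : List A.E} {i i' : Bool} {L L' : List (A.compose B).E} :
    onLeft A B l ++ link A B i :: L = onLeft A B l' ++ link A B i' :: L' ↔
      l = l' ∧ i = i' ∧ L = L' := by
  induction l generalizing l' with
  | nil =>
    cases l' <;> simp [onLeft, link]
  | cons e l ih =>
    cases l' with
    | nil => simp [onLeft, link]
    | cons e' l' =>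
      simp only [onLeft, link] at ih
      simp [onLeft, link, ih, and_assoc]

theorem onRight_append_link_inj {l l' : List B.E} {i i' : Bool} {L L' : List (A.compose B).E} :
    onRight A B l ++ link A B i :: L = onRight A B l' ++ link A B i' :: L' ↔
      l = l' ∧ i = i' ∧ L = L' := by
  induction l generalizing l' with
  | nil =>
    cases l' <;> simp [onRight, link]
  | cons e l ih =>
    cases l' with
    | nil => simp [onRight, link]
    | cons e' l' =>
      simp only [onRight, link] at ih
      simp [onRight, link, ih, and_assoc]

theorem onLeft_ne_append_link {l l' : List A.E} {i : Bool} {L : List (A.compose B).E} :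
    onLeft A B l ≠ onLeft A B l' ++ link A B i :: L := by
  intro h
  have : link A B i ∈ onLeft A B l := by rw [h]; simp
  simp [onLeft, link] at this

theorem exhausts_compose_iff {l : List A.E} {m : List B.E} :
    Exhausts (onLeft A B l ++ onRight A B m ++ [link A B false, link A B true]) ↔
      Exhausts l ∧ Exhausts m := by
  have hl : (onLeft A B l).Nodup ↔ l.Nodup := List.nodup_map_iff Sum.inl_injective
  have hm : (onRight A B m).Nodup ↔ m.Nodup :=
    List.nodup_map_iff (Sum.inr_injective.comp Sum.inl_injective)
  simp only [Exhausts, List.nodup_append, hl, hm]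
  constructor
  · rintro ⟨h, h'⟩
    refine ⟨⟨h.1.1, fun e => ?_⟩, h.1.2.1, fun e => ?_⟩
    · simpa [onLeft, onRight, link] using h' (.inl e)
    · simpa [onLeft, onRight, link] using h' (.inr (.inl e))
  · rintro ⟨⟨h1, h2⟩, h3, h4⟩
    refine ⟨⟨⟨h1, h3, ?_⟩, ?_, ?_⟩, ?_⟩
    · simp [onLeft, onRight]
    · simp [link]
    · simp [onLeft, onRight, link]
    · rintro (e | e | _ | _)
      · simp [onLeft, onRight, link, h2]
      · simp [onLeft, onRight, link, h4]
      · simp [onLeft, onRight, link]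
      · simp [onLeft, onRight, link]

theorem exhausts_compose_of_perm {L : List (A.compose B).E} {l : List A.E} {m : List B.E}
    (i : Bool) (h : L.Perm (onLeft A B l ++ onRight A B m ++ [link A B i, link A B !i])) :
    Exhausts L ↔ Exhausts l ∧ Exhausts m := by
  rw [Exhausts.perm h, ← exhausts_compose_iff]
  cases i
  · rfl
  · exact Exhausts.perm ((List.Perm.swap _ _ _).append_left _)

end Compose

end GraphGadget

namespace GraphGadget

/-- Counts `T` by splitting it into disjoint pieces, the piece `i` being parametrized injectively by
`S i`. -/
theorem ncard_eq_sum_of_parametrization {ι α β : Type*} [Fintype ι] {T : Set β} (hT : T.Finite)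
    (f : ι → α → β) (S : ι → Set α) (hmem : ∀ i q, f i q ∈ T ↔ q ∈ S i)
    (hsurj : ∀ p ∈ T, ∃ i q, f i q = p) (hinj : ∀ i j q r, f i q = f j r → i = j ∧ q = r) :
    T.ncard = ∑ i, (S i).ncard := by
  have := hT.to_subtype
  let g : (Σ i, S i) → T := fun x => ⟨f x.1 x.2, (hmem _ _).2 x.2.2⟩
  have hg : Function.Bijective g := by
    constructor
    · rintro ⟨i, q, hq⟩ ⟨j, r, hr⟩ h
      obtain ⟨rfl, rfl⟩ := hinj i j q r (congrArg Subtype.val h)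
      rfl
    · rintro ⟨p, hp⟩
      obtain ⟨i, q, rfl⟩ := hsurj p hp
      exact ⟨⟨i, q, (hmem i q).1 hp⟩, rfl⟩
  have := Finite.of_injective g hg.1
  have (i : ι) : Finite (S i) := Finite.of_injective (fun q : S i => (⟨i, q⟩ : Σ i, S i))
    fun _ _ h => by simpa using h
  rw [← Nat.card_coe_set_eq, ← Nat.card_eq_of_bijective g hg, Nat.card_sigma]
  rfl

section Perm

variable {α : Type*} (l₁ l₂ m₁ m₂ : List α) (x y : α)

theorem perm_of_crossRoutes : ((l₁ ++ x :: m₁) ++ (l₂ ++ y :: m₂)).Perm (l₁ ++ l₂ ++ (m₁ ++ m₂) ++ [x, y]) := by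
  classical
  rw [List.perm_iff_count]
  intro e
  simp only [List.count_append, List.count_cons, List.count_nil]
  omega

theorem perm_of_leftDetour : ((l₁ ++ x :: (m₁ ++ y :: l₂)) ++ m₂).Perm (l₁ ++ l₂ ++ (m₁ ++ m₂) ++ [x, y]) := by
  classical
  rw [List.perm_iff_count]
  intro e
  simp only [List.count_append, List.count_cons, List.count_nil]
  omega

theorem perm_of_rightDetour : (l₁ ++ (m₁ ++ x :: (l₂ ++ y :: m₂))).Perm (l₁ ++ l₂ ++ (m₁ ++ m₂) ++ [x, y]) := by
  classical
  rw [List.perm_iff_count]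
  intro e
  simp only [List.count_append, List.count_cons, List.count_nil]
  omega

end Perm

/-! ### Classification and counting of the route pairs of a composition. -/

section Compose

variable {A B : GraphGadget}

theorem onLeft_append (l l' : List A.E) : onLeft A B (l ++ l') = onLeft A B l ++ onLeft A B l' :=
  List.map_append

theorem onRight_append (l l' : List B.E) :
    onRight A B (l ++ l') = onRight A B l ++ onRight A B l' :=
  List.map_append

theorem link_injective : Function.Injective (link A B) :=
  Sum.inr_injective.comp Sum.inr_injective

/-- Pigeonhole: there are only two connecting edges. Hence a trail changes sides at most twice,
which ends the case analyses below. -/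
theorem not_nodup_of_three_links {L : List (A.compose B).E} {i j k : Bool}
    (h : [link A B i, link A B j, link A B k].Sublist L) : ¬ L.Nodup := by
  intro hL
  have := h.nodup hL
  simp only [List.nodup_cons, List.mem_cons, link_injective.eq_iff] at this
  revert i j k
  simp

theorem isWalk_onLeft_inl {u w : A.V} {l : List A.E} :
    (A.compose B).IsWalk (.inl u) (onLeft A B l) (.inl w) ↔ A.IsWalk u l w := by
  simp [isWalk_onLeft_iff]

theorem isWalk_onRight_inr {u w : B.V} {l : List B.E} :
    (A.compose B).IsWalk (.inr u) (onRight A B l) (.inr w) ↔ B.IsWalk u l w := by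
  simp [isWalk_onRight_iff]

/-- The pair of routes of the composition in which both routes use one connecting edge. -/
def crossRoutes (A B : GraphGadget) (i : Bool) (q : (List A.E × List A.E) × List B.E × List B.E) :
    List (A.compose B).E × List (A.compose B).E :=
  (onLeft A B q.1.1 ++ link A B i :: onRight A B q.2.1,
    onLeft A B q.1.2 ++ link A B (!i) :: onRight A B q.2.2)

/-- The pair of routes of the composition in which the first route makes a detour through the
second gadget. -/
def leftDetour (A B : GraphGadget) (i : Bool) (q : (List A.E × List A.E) × List B.E × List B.E) :
    List (A.compose B).E × List (A.compose B).E :=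
  (onLeft A B q.1.1 ++ link A B i :: (onRight A B q.2.1 ++ link A B (!i) :: onLeft A B q.1.2),
    onRight A B q.2.2)

/-- The pair of routes of the composition in which the second route makes a detour through the
first gadget. -/
def rightDetour (A B : GraphGadget) (i : Bool) (q : (List A.E × List A.E) × List B.E × List B.E) :
    List (A.compose B).E × List (A.compose B).E :=
  (onLeft A B q.1.1,
    onRight A B q.2.1 ++ link A B i :: (onLeft A B q.1.2 ++ link A B (!i) :: onRight A B q.2.2))

variable {a b c d : Fin 4}

theorem crossRoutes_mem_VR (ha : composeHalf A B a = .inl (A.half a))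
    (hb : composeHalf A B b = .inl (A.half b)) (hc : composeHalf A B c = .inr (B.half c))
    (hd : composeHalf A B d = .inr (B.half d)) (i : Bool)
    (q : (List A.E × List A.E) × List B.E × List B.E) :
    crossRoutes A B i q ∈ (A.compose B).VR a c b d ↔
      q ∈ A.VR a (outPort i) b (outPort !i) ×ˢ B.VR (inPort i) c (inPort !i) d := by
  obtain ⟨⟨l₁, l₂⟩, m₁, m₂⟩ := q
  have hE : Exhausts ((crossRoutes A B i ((l₁, l₂), m₁, m₂)).1 ++
      (crossRoutes A B i ((l₁, l₂), m₁, m₂)).2) ↔ Exhausts (l₁ ++ l₂) ∧ Exhausts (m₁ ++ m₂) := by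
    apply exhausts_compose_of_perm i
    rw [onLeft_append, onRight_append]
    exact perm_of_crossRoutes _ _ _ _ _ _
  have h₁ := (isWalk_onLeft_link (u := A.half a) (l := l₁) (i := i)).trans
    (and_congr_right' (isWalk_onRight_inr (w := B.half c) (l := m₁)))
  have h₂ := (isWalk_onLeft_link (u := A.half b) (l := l₂) (i := !i)).trans
    (and_congr_right' (isWalk_onRight_inr (w := B.half d) (l := m₂)))
  rw [mem_VR, hE]
  simp only [ha, hb, hc, hd, Set.mem_prod, mem_VR]
  exact (and_congr h₁ (and_congr h₂ Iff.rfl)).trans (by tauto)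

theorem leftDetour_mem_VR (ha : composeHalf A B a = .inl (A.half a))
    (hb : composeHalf A B b = .inl (A.half b)) (hc : composeHalf A B c = .inr (B.half c))
    (hd : composeHalf A B d = .inr (B.half d)) (i : Bool)
    (q : (List A.E × List A.E) × List B.E × List B.E) :
    leftDetour A B i q ∈ (A.compose B).VR a b c d ↔
      q ∈ A.VR a (outPort i) (outPort !i) b ×ˢ B.VR (inPort i) (inPort !i) c d := by
  obtain ⟨⟨l₁, l₂⟩, m₁, m₂⟩ := q
  have hE : Exhausts ((leftDetour A B i ((l₁, l₂), m₁, m₂)).1 ++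
      (leftDetour A B i ((l₁, l₂), m₁, m₂)).2) ↔ Exhausts (l₁ ++ l₂) ∧ Exhausts (m₁ ++ m₂) := by
    apply exhausts_compose_of_perm i
    rw [onLeft_append, onRight_append]
    exact perm_of_leftDetour _ _ _ _ _ _
  have h₁ := (isWalk_onLeft_link (u := A.half a) (l := l₁) (i := i)).trans
    (and_congr_right' ((isWalk_onRight_link (l := m₁) (i := !i)).trans
      (and_congr_right' (isWalk_onLeft_inl (w := A.half b) (l := l₂)))))
  have h₂ := isWalk_onRight_inr (A := A) (u := B.half c) (w := B.half d) (l := m₂)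
  rw [mem_VR, hE]
  simp only [ha, hb, hc, hd, Set.mem_prod, mem_VR]
  exact (and_congr h₁ (and_congr h₂ Iff.rfl)).trans (by tauto)

theorem rightDetour_mem_VR (ha : composeHalf A B a = .inl (A.half a))
    (hb : composeHalf A B b = .inl (A.half b)) (hc : composeHalf A B c = .inr (B.half c))
    (hd : composeHalf A B d = .inr (B.half d)) (i : Bool)
    (q : (List A.E × List A.E) × List B.E × List B.E) :
    rightDetour A B i q ∈ (A.compose B).VR a b c d ↔
      q ∈ A.VR a b (outPort i) (outPort !i) ×ˢ B.VR c (inPort i) (inPort !i) d := by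
  obtain ⟨⟨l₁, l₂⟩, m₁, m₂⟩ := q
  have hE : Exhausts ((rightDetour A B i ((l₁, l₂), m₁, m₂)).1 ++
      (rightDetour A B i ((l₁, l₂), m₁, m₂)).2) ↔ Exhausts (l₁ ++ l₂) ∧ Exhausts (m₁ ++ m₂) := by
    apply exhausts_compose_of_perm i
    rw [onLeft_append, onRight_append]
    exact perm_of_rightDetour _ _ _ _ _ _
  have h₁ := isWalk_onLeft_inl (B := B) (u := A.half a) (w := A.half b) (l := l₁)
  have h₂ := (isWalk_onRight_link (u := B.half c) (l := m₁) (i := i)).trans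
    (and_congr_right' ((isWalk_onLeft_link (l := l₂) (i := !i)).trans
      (and_congr_right' (isWalk_onRight_inr (w := B.half d) (l := m₂)))))
  rw [mem_VR, hE]
  simp only [ha, hb, hc, hd, Set.mem_prod, mem_VR]
  exact (and_congr h₁ (and_congr h₂ Iff.rfl)).trans (by tauto)

theorem IsWalk.inl_inr_cases {u : A.V} {w : B.V} {L : List (A.compose B).E}
    (h : (A.compose B).IsWalk (.inl u) L (.inr w)) (hL : L.Nodup) :
    ∃ l i m, L = onLeft A B l ++ link A B i :: onRight A B m := by
  rcases h.inl_cases with ⟨l, rfl⟩ | ⟨l, i, L, rfl⟩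
  · simp [isWalk_onLeft_iff] at h
  have h₁ := (isWalk_onLeft_link.1 h).2
  rcases h₁.inr_cases with ⟨m, rfl⟩ | ⟨m, j, L, rfl⟩
  · exact ⟨l, i, m, rfl⟩
  have h₂ := (isWalk_onRight_link.1 h₁).2
  rcases h₂.inl_cases with ⟨l', rfl⟩ | ⟨l', k, L, rfl⟩
  · simp [isWalk_onLeft_iff] at h₂
  refine (not_nodup_of_three_links (i := i) (j := j) (k := k) ?_ hL).elim
  refine .trans ?_ (List.sublist_append_right _ _)
  refine .cons_cons _ (.trans ?_ (List.sublist_append_right _ _))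
  refine .cons_cons _ (.trans ?_ (List.sublist_append_right _ _))
  exact .cons_cons _ (List.nil_sublist _)

theorem IsWalk.inl_inl_cases {u w : A.V} {L : List (A.compose B).E}
    (h : (A.compose B).IsWalk (.inl u) L (.inl w)) (hL : L.Nodup) :
    (∃ l, L = onLeft A B l) ∨
      ∃ l i m l', L = onLeft A B l ++ link A B i ::
        (onRight A B m ++ link A B (!i) :: onLeft A B l') := by
  rcases h.inl_cases with ⟨l, rfl⟩ | ⟨l, i, L, rfl⟩
  · exact .inl ⟨l, rfl⟩
  have h₁ := (isWalk_onLeft_link.1 h).2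
  rcases h₁.inr_cases with ⟨m, rfl⟩ | ⟨m, j, L, rfl⟩
  · simp [isWalk_onRight_iff] at h₁
  have h₂ := (isWalk_onRight_link.1 h₁).2
  rcases h₂.inl_cases with ⟨l', rfl⟩ | ⟨l', k, L, rfl⟩
  · refine .inr ⟨l, i, m, l', ?_⟩
    have hij : i ≠ j := by
      rintro rfl
      simp [List.nodup_append, List.nodup_cons] at hL
    rw [Bool.eq_not_of_ne hij.symm]
  refine (not_nodup_of_three_links (i := i) (j := j) (k := k) ?_ hL).elim
  refine .trans ?_ (List.sublist_append_right _ _)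
  refine .cons_cons _ (.trans ?_ (List.sublist_append_right _ _))
  refine .cons_cons _ (.trans ?_ (List.sublist_append_right _ _))
  exact .cons_cons _ (List.nil_sublist _)

theorem IsWalk.inr_inr_cases {u w : B.V} {L : List (A.compose B).E}
    (h : (A.compose B).IsWalk (.inr u) L (.inr w)) (hL : L.Nodup) :
    (∃ m, L = onRight A B m) ∨
      ∃ m i l m', L = onRight A B m ++ link A B i ::
        (onLeft A B l ++ link A B (!i) :: onRight A B m') := by
  rcases h.inr_cases with ⟨l, rfl⟩ | ⟨l, i, L, rfl⟩
  · exact .inl ⟨l, rfl⟩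
  have h₁ := (isWalk_onRight_link.1 h).2
  rcases h₁.inl_cases with ⟨m, rfl⟩ | ⟨m, j, L, rfl⟩
  · simp [isWalk_onLeft_iff] at h₁
  have h₂ := (isWalk_onLeft_link.1 h₁).2
  rcases h₂.inr_cases with ⟨l', rfl⟩ | ⟨l', k, L, rfl⟩
  · refine .inr ⟨l, i, m, l', ?_⟩
    have hij : i ≠ j := by
      rintro rfl
      simp [List.nodup_append, List.nodup_cons] at hL
    rw [Bool.eq_not_of_ne hij.symm]
  refine (not_nodup_of_three_links (i := i) (j := j) (k := k) ?_ hL).elim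
  refine .trans ?_ (List.sublist_append_right _ _)
  refine .cons_cons _ (.trans ?_ (List.sublist_append_right _ _))
  refine .cons_cons _ (.trans ?_ (List.sublist_append_right _ _))
  exact .cons_cons _ (List.nil_sublist _)

/-- Each route changes sides an odd number of times, hence once. The two summands correspond to
which connecting edge the first route takes. -/
theorem ncard_VR_compose_cross (ha : composeHalf A B a = .inl (A.half a))
    (hb : composeHalf A B b = .inl (A.half b)) (hc : composeHalf A B c = .inr (B.half c))
    (hd : composeHalf A B d = .inr (B.half d)) :
    ((A.compose B).VR a c b d).ncard =
      (A.VR a 2 b 3).ncard * (B.VR 0 c 1 d).ncard +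
        (A.VR a 3 b 2).ncard * (B.VR 1 c 0 d).ncard := by
  rw [ncard_eq_sum_of_parametrization (finite_VR _ _ _ _ _) (crossRoutes A B) _
    (crossRoutes_mem_VR ha hb hc hd)]
  · simp only [Fintype.sum_bool, Set.ncard_prod, outPort, inPort, Bool.not_true, Bool.not_false]
    exact add_comm _ _
  · rintro ⟨p₁, p₂⟩ h
    rw [mem_VR] at h
    simp only [ha, hb, hc, hd] at h
    obtain ⟨h₁, h₂, hE⟩ := h
    obtain ⟨l₁, i, m₁, rfl⟩ := h₁.inl_inr_cases hE.1.of_append_left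
    obtain ⟨l₂, j, m₂, rfl⟩ := h₂.inl_inr_cases hE.1.of_append_right
    refine ⟨i, ((l₁, l₂), m₁, m₂), ?_⟩
    have hij : i ≠ j := by
      rintro rfl
      have := List.disjoint_of_nodup_append hE.1 (a := link A B i) (by simp) (by simp)
      exact this
    rw [Bool.eq_not_of_ne hij.symm]
    rfl
  · rintro i j ⟨⟨l₁, l₂⟩, m₁, m₂⟩ ⟨⟨l₁', l₂'⟩, m₁', m₂'⟩ h
    obtain ⟨rfl, rfl, h₁⟩ := onLeft_append_link_inj.1 (congrArg Prod.fst h)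
    obtain ⟨rfl, -, h₂⟩ := onLeft_append_link_inj.1 (congrArg Prod.snd h)
    obtain rfl := onRight_injective h₁
    obtain rfl := onRight_injective h₂
    exact ⟨rfl, rfl⟩

/-- Each route changes sides an even number of times and both connecting edges must be used, so
exactly one route makes a detour, in one of two directions. -/
theorem ncard_VR_compose_parallel (ha : composeHalf A B a = .inl (A.half a))
    (hb : composeHalf A B b = .inl (A.half b)) (hc : composeHalf A B c = .inr (B.half c))
    (hd : composeHalf A B d = .inr (B.half d)) :
    ((A.compose B).VR a b c d).ncard =
      (A.VR a 2 3 b).ncard * (B.VR 0 1 c d).ncard + (A.VR a 3 2 b).ncard * (B.VR 1 0 c d).ncard +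
      ((A.VR a b 2 3).ncard * (B.VR c 0 1 d).ncard +
        (A.VR a b 3 2).ncard * (B.VR c 1 0 d).ncard) := by
  rw [ncard_eq_sum_of_parametrization (finite_VR _ _ _ _ _)
    (Sum.elim (leftDetour A B) (rightDetour A B))
    (Sum.elim (fun i => A.VR a (outPort i) (outPort !i) b ×ˢ B.VR (inPort i) (inPort !i) c d)
      (fun i => A.VR a b (outPort i) (outPort !i) ×ˢ B.VR c (inPort i) (inPort !i) d))]
  · simp only [Fintype.sum_sum_type, Fintype.sum_bool, Sum.elim_inl, Sum.elim_inr, Set.ncard_prod,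
      outPort, inPort, Bool.not_true, Bool.not_false]
    ring
  · rintro (i | i) q
    · exact leftDetour_mem_VR ha hb hc hd i q
    · exact rightDetour_mem_VR ha hb hc hd i q
  · rintro ⟨p₁, p₂⟩ h
    rw [mem_VR] at h
    simp only [ha, hb, hc, hd] at h
    obtain ⟨h₁, h₂, hE⟩ := h
    rcases h₁.inl_inl_cases hE.1.of_append_left with ⟨l₁, rfl⟩ | ⟨l₁, i, m₁, l₂, rfl⟩ <;>
    rcases h₂.inr_inr_cases hE.1.of_append_right with ⟨m₂, rfl⟩ | ⟨m₂, j, l₃, m₃, rfl⟩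
    · have := hE.2 (link A B true)
      simp [onLeft, onRight, link] at this
    · exact ⟨.inr j, ((l₁, l₃), m₂, m₃), rfl⟩
    · exact ⟨.inl i, ((l₁, l₂), m₁, m₂), rfl⟩
    · refine (List.disjoint_of_nodup_append hE.1 (a := link A B i) (by simp) ?_).elim
      cases i <;> cases j <;> simp
  · rintro (i | i) (j | j) ⟨⟨l₁, l₂⟩, m₁, m₂⟩ ⟨⟨l₁', l₂'⟩, m₁', m₂'⟩ h
    · obtain ⟨rfl, rfl, h₁⟩ := onLeft_append_link_inj.1 (congrArg Prod.fst h)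
      obtain ⟨rfl, -, h₁⟩ := onRight_append_link_inj.1 h₁
      obtain rfl := onLeft_injective h₁
      obtain rfl := onRight_injective (congrArg Prod.snd h)
      exact ⟨rfl, rfl⟩
    · exact (onLeft_ne_append_link (congrArg Prod.fst h).symm).elim
    · exact (onLeft_ne_append_link (congrArg Prod.fst h)).elim
    · obtain ⟨rfl, rfl, h₁⟩ := onRight_append_link_inj.1 (congrArg Prod.snd h)
      obtain ⟨rfl, -, h₁⟩ := onLeft_append_link_inj.1 h₁
      obtain rfl := onRight_injective h₁
      obtain rfl := onLeft_injective (congrArg Prod.fst h)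
      exact ⟨rfl, rfl⟩

/-- The numbers of valid sets of routes of a composition. -/
theorem routeCount_compose (A B : GraphGadget) :
    (A.compose B).routeCount =
      ![A.routeCount 0 * (B.routeCount 1 + B.routeCount 2) +
          (A.routeCount 1 + A.routeCount 2) * B.routeCount 0,
        A.routeCount 1 * B.routeCount 1 + A.routeCount 2 * B.routeCount 2,
        A.routeCount 1 * B.routeCount 2 + A.routeCount 2 * B.routeCount 1] := by
  funext k
  fin_cases k
  · simp only [routeCount, Fin.zero_eta, Matrix.cons_val_zero, Matrix.cons_val_one,
      Matrix.cons_val]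
    rw [ncard_VR_compose_parallel rfl rfl rfl rfl, A.ncard_VR_reverse_right 0 2 1 3,
      A.ncard_VR_reverse_right 0 3 1 2, A.ncard_VR_reverse_right 0 1 2 3,
      B.ncard_VR_reverse_left 0 1 2 3, B.ncard_VR_reverse_left 0 2 1 3,
      B.ncard_VR_swap 2 1, B.ncard_VR_reverse_right 0 3 1 2]
    ring
  · simp only [routeCount, Fin.mk_one, Matrix.cons_val_zero, Matrix.cons_val_one,
      Matrix.cons_val]
    rw [ncard_VR_compose_cross rfl rfl rfl rfl, B.ncard_VR_swap 1 2]
  · simp only [routeCount, Fin.reduceFinMk, Matrix.cons_val_zero, Matrix.cons_val_one,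
      Matrix.cons_val]
    rw [ncard_VR_compose_cross rfl rfl rfl rfl, B.ncard_VR_swap 1 3]

end Compose

/-! ### Relabelling half-edges permutes the signature. -/

section Relabel

/-- The gadget whose half-edges are relabelled by a permutation. -/
def relabel (G : GraphGadget) (π : Equiv.Perm (Fin 4)) : GraphGadget where
  V := G.V
  E := G.E
  finite_V := G.finite_V
  finite_E := G.finite_E
  ends := G.ends
  half := G.half ∘ π
  regular v := by
    refine Eq.trans (congrArg _ ?_) (G.regular v)
    exact Set.ncard_preimage_of_injective_subset_range (s := {i | G.half i = v}) π.injective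
      (by simp)

theorem isWalk_relabel (G : GraphGadget) (π : Equiv.Perm (Fin 4)) (u w : G.V) (l : List G.E) :
    (G.relabel π).IsWalk u l w ↔ G.IsWalk u l w := by
  induction l generalizing u with
  | nil => rfl
  | cons e l ih => exact exists_congr fun v => and_congr_right fun _ => ih v

theorem VR_relabel (G : GraphGadget) (π : Equiv.Perm (Fin 4)) (a b c d : Fin 4) :
    (G.relabel π).VR a b c d = G.VR (π a) (π b) (π c) (π d) := by
  ext p
  rw [mem_VR]
  refine Iff.trans ?_ (mem_VR G).symm
  exact and_congr (isWalk_relabel G π _ _ _) (and_congr (isWalk_relabel G π _ _ _) Iff.rfl)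

theorem routeCount_relabel_swap_one_two (G : GraphGadget) :
    (G.relabel (Equiv.swap 1 2)).routeCount = G.routeCount ∘ Equiv.swap 0 1 := by
  funext k
  have h0 : Equiv.swap (1 : Fin 4) 2 0 = 0 := by decide
  have h3 : Equiv.swap (1 : Fin 4) 2 3 = 3 := by decide
  have h2 : Equiv.swap (0 : Fin 3) 1 2 = 2 := by decide
  fin_cases k
  · simp [routeCount, VR_relabel, h0, h3]
    rfl
  · simp [routeCount, VR_relabel, h0, h3]
    rfl
  · simp [routeCount, VR_relabel, h0, h3, h2]
    exact G.ncard_VR_reverse_right 0 3 1 2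

theorem routeCount_relabel_swap_two_three (G : GraphGadget) :
    (G.relabel (Equiv.swap 2 3)).routeCount = G.routeCount ∘ Equiv.swap 1 2 := by
  funext k
  have h0 : Equiv.swap (2 : Fin 4) 3 0 = 0 := by decide
  have h1 : Equiv.swap (2 : Fin 4) 3 1 = 1 := by decide
  have h2 : Equiv.swap (1 : Fin 3) 2 0 = 0 := by decide
  fin_cases k
  · simp [routeCount, VR_relabel, h0, h1, h2]
    exact G.ncard_VR_reverse_right 0 1 2 3
  · simp [routeCount, VR_relabel, h0, h1]
    rfl
  · simp [routeCount, VR_relabel, h0, h1]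
    rfl

theorem HasSignature.of_routeCount_comp {G G' : GraphGadget} {s : Fin 3 → ℝ}
    (h : G.HasSignature s) (σ : Equiv.Perm (Fin 3)) (hG : G'.routeCount = G.routeCount ∘ σ) :
    G'.HasSignature (s ∘ σ) := by
  have hsum : ∑ j, G'.routeCount j = ∑ j, G.routeCount j := by
    rw [hG]
    exact Equiv.sum_comp σ G.routeCount
  refine ⟨hsum ▸ h.1, fun i => ?_⟩
  rw [hsum, hG]
  exact h.2 (σ i)

theorem HasSignature.exists_comp_perm {G : GraphGadget} {s : Fin 3 → ℝ}
    (h : G.HasSignature s) (σ : Equiv.Perm (Fin 3)) :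
    ∃ G' : GraphGadget, G'.HasSignature (s ∘ σ) := by
  have h₁ : ∀ {s : Fin 3 → ℝ}, (∃ G : GraphGadget, G.HasSignature s) →
      ∃ G : GraphGadget, G.HasSignature (s ∘ Equiv.swap (0 : Fin 3) 1) :=
    fun ⟨G, h⟩ => ⟨_, h.of_routeCount_comp _ G.routeCount_relabel_swap_one_two⟩
  have h₂ : ∀ {s : Fin 3 → ℝ}, (∃ G : GraphGadget, G.HasSignature s) →
      ∃ G : GraphGadget, G.HasSignature (s ∘ Equiv.swap (1 : Fin 3) 2) :=
    fun ⟨G, h⟩ => ⟨_, h.of_routeCount_comp _ G.routeCount_relabel_swap_two_three⟩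
  -- The two available transpositions generate all six permutations of the coordinates.
  have hσ : σ ∈ [1, Equiv.swap 0 1, Equiv.swap 1 2, Equiv.swap 0 1 * Equiv.swap 1 2,
      Equiv.swap 1 2 * Equiv.swap 0 1, Equiv.swap 0 1 * Equiv.swap 1 2 * Equiv.swap 0 1] := by
    revert σ
    decide
  simp only [List.mem_cons, List.not_mem_nil, or_false] at hσ
  rcases hσ with rfl | rfl | rfl | rfl | rfl | rfl
  · exact ⟨G, h⟩
  · exact h₁ ⟨G, h⟩
  · exact h₂ ⟨G, h⟩
  · exact h₂ (h₁ ⟨G, h⟩)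
  · exact h₁ (h₂ ⟨G, h⟩)
  · exact h₁ (h₂ (h₁ ⟨G, h⟩))

end Relabel

/-- The gadget with a single vertex and no edges. -/
def single : GraphGadget where
  V := Unit
  E := Empty
  finite_V := inferInstance
  finite_E := inferInstance
  ends := Empty.elim
  half _ := ()
  regular v := by
    rw [Set.eq_empty_of_isEmpty {e : Empty | v ∈ Empty.elim e},
      Set.eq_empty_of_isEmpty {e : Empty | Empty.elim e = s(v, v)}]
    simp [Set.ncard_univ]

theorem routeCount_single : single.routeCount = ![1, 1, 1] := by
  have h (a b c d : Fin 4) : (single.VR a b c d).ncard = 1 := by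
    rw [Set.ncard_eq_one]
    refine ⟨([], []), Set.eq_singleton_iff_unique_mem.2 ⟨?_, ?_⟩⟩
    · rw [mem_VR]
      exact ⟨rfl, rfl, List.nodup_nil, fun e => e.elim⟩
    · rintro ⟨l, m⟩ -
      rcases l with _ | ⟨e, l⟩
      · rcases m with _ | ⟨e, m⟩
        · rfl
        · exact e.elim
      · exact e.elim
  simp [routeCount, h]

end GraphGadget

/-! ### The coordinates `(u, v)` and the attained pairs. -/

open Filter Topology

namespace GraphGadget

/-- Some gadget with numbers of valid sets of routes `x, y, z` has `x / (y + z) = u` and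
`(y - z) / (y + z) = v`. -/
def Attains (u v : ℝ) : Prop :=
  ∃ G : GraphGadget, (0 : ℝ) < G.routeCount 1 + G.routeCount 2 ∧
    (G.routeCount 0 : ℝ) = u * (G.routeCount 1 + G.routeCount 2) ∧
    (G.routeCount 1 - G.routeCount 2 : ℝ) = v * (G.routeCount 1 + G.routeCount 2)

theorem attains_single : Attains (1 / 2) 0 := by
  refine ⟨single, ?_, ?_, ?_⟩ <;> rw [routeCount_single] <;>
    simp only [Matrix.cons_val_zero, Matrix.cons_val_one, Matrix.cons_val] <;> norm_num

theorem Attains.nonneg {u v : ℝ} (h : Attains u v) : 0 ≤ u := by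
  obtain ⟨G, h₀, h₁, -⟩ := h
  exact nonneg_of_mul_nonneg_left (h₁ ▸ Nat.cast_nonneg _) h₀

theorem Attains.compose {u v u' v' : ℝ} (h : Attains u v) (h' : Attains u' v') :
    Attains (u + u') (v * v') := by
  obtain ⟨A, hA₀, hA₁, hA₂⟩ := h
  obtain ⟨B, hB₀, hB₁, hB₂⟩ := h'
  refine ⟨A.compose B, ?_, ?_, ?_⟩ <;> rw [routeCount_compose] <;>
    simp only [Matrix.cons_val_zero, Matrix.cons_val_one, Matrix.cons_val] <;> push_cast
  · linarith [mul_pos hA₀ hB₀]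
  · rw [hA₁, hB₁]
    ring
  · calc _ = ((A.routeCount 1 : ℝ) - A.routeCount 2) * (B.routeCount 1 - B.routeCount 2) := by ring
      _ = _ := by rw [hA₂, hB₂]; ring

/-- Exchanges `x` and `y`; the denominator `2 * u + 1 - v` is `2 * (x + z) / (y + z)`. -/
theorem Attains.swap {u v : ℝ} (h : Attains u v) (huv : 0 < 2 * u + 1 - v) :
    Attains ((1 + v) / (2 * u + 1 - v)) ((2 * u - 1 + v) / (2 * u + 1 - v)) := by
  obtain ⟨A, h₀, h₁, h₂⟩ := h
  have e0 : (Equiv.swap (0 : Fin 3) 1) 0 = 1 := by decide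
  have e1 : (Equiv.swap (0 : Fin 3) 1) 1 = 0 := by decide
  have e2 : (Equiv.swap (0 : Fin 3) 1) 2 = 2 := by decide
  refine ⟨A.relabel (Equiv.swap 1 2), ?_, ?_, ?_⟩ <;>
    rw [routeCount_relabel_swap_one_two] <;> simp only [Function.comp_apply, e0, e1, e2]
  · linarith [mul_pos h₀ huv]
  · rw [div_mul_eq_mul_div, eq_div_iff huv.ne', h₁]
    linear_combination (u + 1) * h₂
  · rw [div_mul_eq_mul_div, eq_div_iff huv.ne', h₁]
    linear_combination 2 * u * h₂

theorem Attains.pow {u v : ℝ} (h : Attains u v) {k : ℕ} (hk : 1 ≤ k) :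
    Attains (k * u) (v ^ k) := by
  induction k, hk using Nat.le_induction with
  | base => simpa using h
  | succ k _ ih =>
    have := ih.compose h
    rwa [← pow_succ, ← add_one_mul, ← Nat.cast_add_one] at this

theorem attains_chain {m k : ℕ} (hm : 2 ≤ m) (hk : 1 ≤ k) :
    Attains (k / m) ((1 - 2 / m) ^ k) := by
  obtain ⟨n, rfl⟩ : ∃ n, m = n + 1 := ⟨m - 1, by omega⟩
  have hn : 1 ≤ n := by omega
  -- A chain of `m - 1` vertices has coordinates `((m - 1)/2, 0)`; its swap is `(1/m, 1 - 2/m)`.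
  have h := attains_single.pow hn
  rw [zero_pow (by omega)] at h
  have hpos : (0 : ℝ) < n + 1 := by positivity
  have h := (h.swap (by linarith)).pow hk
  convert h using 1
  · push_cast
    field_simp
    ring
  · congr 1
    push_cast
    field_simp
    ring

/-- Composing with a single vertex makes the second coordinate `0`, so the swapped result depends on
`u` alone. -/
theorem Attains.turn {u v : ℝ} (h : Attains u v) : Attains (1 / (2 * u + 2)) (u / (u + 1)) := by
  have hu := h.nonneg
  have := (h.compose attains_single).swap (by linarith)
  convert this using 1
  · congr 1 <;> ring
  · rw [div_eq_div_iff (by linarith) (by linarith)]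
    ring

/-! ### Limit points of the attained pairs. -/

/-- The closure of the set of pairs described by `Attains`. -/
def attainsClosure : Set (ℝ × ℝ) := closure {p | Attains p.1 p.2}

theorem mem_attainsClosure_exp {t : ℝ} (ht : 0 ≤ t) :
    (t, Real.exp (-2 * t)) ∈ attainsClosure := by
  -- The `+ 1` keeps the chain nonempty, also for `t = 0`, and does not affect the limit.
  have hfrac : Tendsto (fun m : ℕ => ((⌊t * m⌋₊ + 1 : ℕ) : ℝ) / m) atTop (𝓝 t) := by
    have h₁ := (tendsto_nat_floor_mul_div_atTop ht).comp (tendsto_natCast_atTop_atTop (R := ℝ))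
    have h₂ := h₁.add (tendsto_one_div_atTop_nhds_zero_nat (𝕜 := ℝ))
    rw [add_zero] at h₂
    refine h₂.congr fun m => ?_
    simp [add_div]
  have hexp : Tendsto (fun m : ℕ => (1 - 2 / m : ℝ) ^ (⌊t * m⌋₊ + 1)) atTop
      (𝓝 (Real.exp (-2 * t))) := by
    have h₁ := Real.tendsto_one_add_div_pow_exp (-2)
    have h₂ := h₁.rpow hfrac (.inl (Real.exp_pos _).ne')
    rw [← Real.exp_mul] at h₂
    refine h₂.congr' ?_
    filter_upwards [eventually_ge_atTop 2] with m hm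
    have hm' : (2 : ℝ) ≤ m := by exact_mod_cast hm
    have hpos : (0 : ℝ) < m := by linarith
    have hbase : (0 : ℝ) ≤ 1 + -2 / m := by
      rw [neg_div, ← sub_eq_add_neg, sub_nonneg, div_le_one hpos]
      exact hm'
    rw [← Real.rpow_natCast, ← Real.rpow_mul hbase, mul_div_cancel₀ _ hpos.ne',
      Real.rpow_natCast, neg_div, ← sub_eq_add_neg]
  refine mem_closure_of_tendsto (hfrac.prodMk_nhds hexp) ?_
  filter_upwards [eventually_ge_atTop 2] with m hm
  exact attains_chain hm (by omega)

theorem mem_attainsClosure_compose {p q : ℝ × ℝ} (hp : p ∈ attainsClosure)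
    (hq : q ∈ attainsClosure) : (p.1 + q.1, p.2 * q.2) ∈ attainsClosure :=
  map_mem_closure₂ (f := fun p q : ℝ × ℝ => (p.1 + q.1, p.2 * q.2)) (by fun_prop) hp hq
    fun _ h _ h' => h.compose h'

theorem mem_attainsClosure_line {u : ℝ} (hu : 0 ≤ u) (hu' : u ≤ 1 / 2) :
    (u, 1 - 2 * u) ∈ attainsClosure := by
  rcases hu.eq_or_lt with rfl | hu
  · simpa using mem_attainsClosure_exp le_rfl
  -- This value `c` solves `1 / (2 * c + 2) = u`; nonnegativity is where `u ≤ 1 / 2` enters.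
  have hc : 0 ≤ 1 / (2 * u) - 1 := by
    rw [sub_nonneg, le_div_iff₀ (by linarith)]
    linarith
  have h := mem_attainsClosure_exp hc
  set c := 1 / (2 * u) - 1 with hc_def
  have hcont : ContinuousAt (fun p : ℝ × ℝ => (1 / (2 * p.1 + 2), p.1 / (p.1 + 1)))
      (c, Real.exp (-2 * c)) := by
    have h₁ : 2 * c + 2 ≠ 0 := by linarith
    have h₂ : c + 1 ≠ 0 := by linarith
    exact ContinuousAt.prodMk (by fun_prop (disch := exact h₁)) (by fun_prop (disch := exact h₂))
  have := hcont.continuousWithinAt.mem_closure h (t := {p : ℝ × ℝ | Attains p.1 p.2})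
    fun p hp => Attains.turn hp
  have h₁ : 1 / (2 * c + 2) = u := by
    rw [hc_def]
    field_simp
    ring
  have h₂ : c / (c + 1) = 1 - 2 * u := by
    rw [hc_def, sub_add_cancel]
    field_simp
  simpa only [h₁, h₂, attainsClosure] using this

theorem mem_attainsClosure {u v : ℝ} (hu : 0 ≤ u) (hv : 0 ≤ v) (huv : 1 - 2 * u ≤ v)
    (hexp : v ≤ Real.exp (-2 * u)) : (u, v) ∈ attainsClosure := by
  have hm : 0 ≤ min u (1 / 2) := le_min hu (by norm_num)
  have hcont : ContinuousOn (fun r => (1 - 2 * r) * Real.exp (-2 * (u - r)))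
      (Set.Icc 0 (min u (1 / 2))) := by fun_prop
  -- At `r = 0` the function is `exp (-2u)`; at the right end it is `1 - 2u` if `u ≤ 1 / 2` and `0`
  -- otherwise.
  obtain ⟨r, ⟨hr₀, hr₁⟩, hr⟩ := intermediate_value_Icc' hm hcont (show v ∈ Set.Icc _ _ by
    refine ⟨?_, by simpa using hexp⟩
    rcases le_total u (1 / 2) with h | h
    · rw [min_eq_left h]
      simpa using huv
    · rw [min_eq_right h]
      simpa using hv)
  have := mem_attainsClosure_compose
    (mem_attainsClosure_line hr₀ (hr₁.trans (min_le_right _ _)))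
    (mem_attainsClosure_exp (sub_nonneg.2 (hr₁.trans (min_le_left _ _))))
  simp only at this hr
  rwa [add_sub_cancel, hr] at this

/-! ### From attained pairs back to signatures. -/

/-- The signature of a gadget with `x / (y + z) = u` and `(y - z) / (y + z) = v`, the coordinates
being listed in the order `y, x, z`. -/
noncomputable def ratioSignature (p : ℝ × ℝ) : Fin 3 → ℝ :=
  ![(1 + p.2) / (2 * (1 + p.1)), p.1 / (1 + p.1), (1 - p.2) / (2 * (1 + p.1))]

theorem Attains.exists_hasSignature {p : ℝ × ℝ} (h : Attains p.1 p.2) (σ : Equiv.Perm (Fin 3)) :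
    ∃ G : GraphGadget, G.HasSignature (ratioSignature p ∘ σ) := by
  have hu := h.nonneg
  obtain ⟨G, h₀, h₁, h₂⟩ := h
  have hsig : G.HasSignature (ratioSignature p ∘ Equiv.swap 0 1) := by
    have hu' : (0 : ℝ) < 1 + p.1 := by linarith
    have hS : ((∑ j, G.routeCount j : ℕ) : ℝ)
        = (1 + p.1) * (G.routeCount 1 + G.routeCount 2) := by
      rw [Fin.sum_univ_three]
      push_cast
      rw [h₁]
      ring
    have hpos := mul_pos hu' h₀
    refine ⟨fun h => ?_, fun i => ?_⟩
    · rw [h, Nat.cast_zero] at hS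
      linarith
    · rw [hS, eq_div_iff hpos.ne']
      fin_cases i
      · simp only [ratioSignature, Function.comp_apply, Fin.zero_eta, Equiv.swap_apply_left,
          Matrix.cons_val_one, Matrix.cons_val_zero]
        field_simp
        linarith
      · simp only [ratioSignature, Function.comp_apply, Fin.mk_one, Equiv.swap_apply_right,
          Matrix.cons_val_zero]
        field_simp
        linarith
      · rw [Function.comp_apply, Equiv.swap_apply_of_ne_of_ne (by decide) (by decide)]
        simp only [ratioSignature, Fin.reduceFinMk, Matrix.cons_val]
        field_simp
        linarith
  -- `ratioSignature` lists `y, x, z` while the gadget lists `x, y, z`; the extra transposition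
  -- cancels the one in `hsig`.
  obtain ⟨G', h'⟩ := hsig.exists_comp_perm (Equiv.swap 0 1 * σ)
  refine ⟨G', ?_⟩
  convert h' using 1
  ext i
  simp

theorem exists_hasSignature_near {p : ℝ × ℝ} (hp : p ∈ attainsClosure) (hp₀ : 0 ≤ p.1)
    (σ : Equiv.Perm (Fin 3)) {ε : ℝ} (hε : 0 < ε) :
    ∃ (G : GraphGadget) (s' : Fin 3 → ℝ), G.HasSignature s' ∧
      ∑ i, |(ratioSignature p ∘ σ) i - s' i| ≤ ε := by
  have h₁ : 1 + p.1 ≠ 0 := by linarith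
  have h₂ : 2 * (1 + p.1) ≠ 0 := by simpa using h₁
  have hcont : ContinuousAt ratioSignature p := by
    refine continuousAt_pi.2 fun i => ?_
    fin_cases i
    · exact ContinuousAt.div (by fun_prop) (by fun_prop) h₂
    · exact ContinuousAt.div (by fun_prop) (by fun_prop) h₁
    · exact ContinuousAt.div (by fun_prop) (by fun_prop) h₂
  have hdist : ContinuousAt
      (fun q => ∑ i, |(ratioSignature p ∘ σ) i - (ratioSignature q ∘ σ) i|) p := by
    refine tendsto_finsetSum _ fun i _ => ?_
    exact (continuousAt_const.sub (continuousAt_pi.1 hcont (σ i))).abs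
  have hev := hdist.eventually_lt_const (u := ε) (by simpa using hε)
  obtain ⟨q, hq, hlt⟩ := ((mem_closure_iff_frequently.1 hp).and_eventually hev).exists
  obtain ⟨G, hG⟩ := Attains.exists_hasSignature hq σ
  exact ⟨G, _, hG, hlt.le⟩

end GraphGadget

open GraphGadget in
theorem mainTheorem6 (s : Fin 3 → ℝ) (hs : s ∈ signatureRegion) (ε : ℝ) (hε : 0 < ε) :
    ∃ (G : GraphGadget) (s' : Fin 3 → ℝ), G.HasSignature s' ∧ ∑ i, |s i - s' i| ≤ ε := by
  obtain ⟨σ, α, β, γ, hαβ, hβγ, hγ, hsum, hf, rfl⟩ := hs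
  -- If `β ≥ 1`, then `α ≥ β` would force the sum above `1`.
  have hp : 0 < 1 - β := by linarith
  have hexp : 2 * β / (β - 1) = -2 * (β / (1 - β)) := by
    rw [← neg_sub 1 β]
    field_simp
  have hu : 0 ≤ β / (1 - β) := div_nonneg (hγ.trans hβγ) hp.le
  have hmem : (β / (1 - β), (α - γ) / (1 - β)) ∈ attainsClosure := by
    -- Since `α - γ = 1 - β - 2γ`, the two remaining inequalities are `γ ≤ β` and `γ ≥ f(β)`.
    refine mem_attainsClosure hu (div_nonneg (by linarith) hp.le) ?_ ?_
    · rw [le_div_iff₀ hp, sub_mul, mul_assoc, div_mul_cancel₀ _ hp.ne']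
      linarith
    · rw [boundaryFun, hexp] at hf
      rw [div_le_iff₀ hp]
      linarith
  have hsig : ratioSignature (β / (1 - β), (α - γ) / (1 - β)) = ![α, β, γ] := by
    have h1 : 1 + β / (1 - β) = 1 / (1 - β) := by field_simp; ring
    funext i
    fin_cases i
    · simp only [ratioSignature, h1, Fin.zero_eta, Matrix.cons_val_zero]
      field_simp
      linarith
    · simp only [ratioSignature, h1, Fin.mk_one, Matrix.cons_val_one, Matrix.cons_val_zero]
      field_simp
    · simp only [ratioSignature, h1, Fin.reduceFinMk, Matrix.cons_val]
      field_simp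
      linarith
  rw [← hsig]
  exact exists_hasSignature_near hmem hu σ hε
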